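/- **Setting.** Let $h$ be a probability density on $\mathbb R$ with mean $0$ and finite positive second moment, $f_0$ a probability density (the null hypothesis), and $d\ge 1$ an integer. For $1\le k\le d$ let $\{f^{(k)}_\theta:\theta\in\Theta_k\}$, $\Theta_k\subseteq\mathbb R^k$, be a family of probability densities with $0\in\Theta_k$ and $f^{(k)}_0=f_0$ a.e.; derivatives relative to $\Theta_k$ are assumed to be unique at each of its points (for instance, $\Theta_k$ is open). The families are nested: identifying $\theta\in\mathbb R^k$ with $(\theta,0)\in\mathbb R^l$ for $k\le l\le d$, one has $\Theta_k\subseteq\Theta_l$ and $f^{(l)}_{(\theta,0)}=f^{(k)}_\theta$ a.e. for $\theta\in\Theta_k$. Put $$q_k(y;\theta)=\int f^{(k)}_\theta(s)\,h(y-s)\,ds,\qquad dQ_{k,\theta}(y)=q_k(y;\theta)\,dy,\qquad \dot l_k(y;\theta)=\frac{\nabla_\theta\, q_k(y;\theta)}{q_k(y;\theta)}\,1_{[q_k(y;\theta)>0]},$$ and $I_k(\theta)=\int \dot l_k\dot l_k^{T}\,dQ_{k,\theta}$. Assume that every one of these families gives a regular deconvolution problem: for every $\theta\in\Theta_k$ the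 function $q_k(y;\cdot)$ is continuously differentiable at $\theta$ for Lebesgue-almost all $y$; $|\dot l_k(\cdot;\theta)|\in L_2(Q_{k,\theta})$; and $I_k(\theta)$ is nonsingular, and continuous in $\theta\in\Theta_k$. Let $F$ be a probability distribution on $\mathbb R$ (not necessarily with a density), and let $Y_j=X_j+\varepsilon_j$, $j=1,2,\dots$, where the $X_j$ are i.i.d. with law $F$, the $\varepsilon_j$ are i.i.d. with density $h$, and all these variables are independent; write $P_F$ for the probability. With the column vector $l^{*}_{(k)}(y)=\dot l_k(y;0)$ and $L_k=I_k(0)^{-1}$ let $$U_k=\Bigl(\tfrac1{\sqrt n}\sum_{j=1}^n l^{*}_{(k)}(Y_j)\Bigr)^{T}L_k\Bigl(\tfrac1{\sqrt n}\sum_{j=1}^n l^{*}_{(k)}(Y_j)\Bigr).$$ Let $\pi:\mathbb N\times\mathbb N\to\mathbb R$ be a penalty, that is, $\pi(1,n)<\dots<\pi(d,n)$ for all $n\ge1$ and $\pi(j,n)-\pi(1,n)\to\infty$ as $n\to\infty$ for $2\le j\le d$, and let $$S=\min\{k: 1\le k\le d,\ U_k-\pi(k,n)\ge U_j-\pi(j,n)\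 \text{for } j=1,\dots,d\}.$$ **Proposition.** Let $l^*_i$ be the $i$-th coordinate of $l^*=l^*_{(d)}$. Suppose that - $\langle D1\rangle$ $K$ is an integer, $1\le K\le d$, such that $l_1^*,\dots,l_K^*$ are integrable with respect to $F*h$ (the law of $Y_1$), $E_{F*h}\,l_i^*=0$ for $1\le i\le K-1$, and $E_{F*h}\,l_K^*\ne0$; - $\langle S1\rangle$ $\pi(k,n)=o(n)$ as $n\to\infty$ for every fixed $k\ge1$. Then, as $n\to\infty$, $P_F(S\ge K)\to1$, and $U_S\to\infty$ in probability, i.e. $P_F(U_S\le t)\to0$ for every $t\in\mathbb R$. -/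

import Mathlib

open MeasureTheory ProbabilityTheory Filter Topology Asymptotics
open scoped Matrix

noncomputable section

namespace SimpleDeconvolution

/-- `g` is a probability density on `ℝ` with respect to Lebesgue measure. -/
structure IsDensity (g : ℝ → ℝ) : Prop where
  measurable : Measurable g
  nonneg : ∀ x, 0 ≤ g x
  integral_eq_one : ∫ x, g x = 1

/-- `h` is a density of the noise: it has mean zero and finite positive second moment. -/
structure IsNoiseDensity (h : ℝ → ℝ) : Prop where
  isDensity : IsDensity h
  integrable_mul : Integrable fun x => x * h x
  mean_eq_zero : ∫ x, x * h x = 0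
  integrable_sq_mul : Integrable fun x => x ^ 2 * h x
  second_moment_pos : 0 < ∫ x, x ^ 2 * h x

/-- The measure with density `g` with respect to Lebesgue measure. -/
def densityMeasure (g : ℝ → ℝ) : Measure ℝ :=
  volume.withDensity fun x => ENNReal.ofReal (g x)

/-- A family `f θ` of functions on `ℝ`, `θ` in a parameter set `Θ` of `k`-dimensional
Euclidean space. (Only the values of `f` at `θ ∈ Θ` matter.) -/
structure ParamFamily (k : ℕ) where
  Θ : Set (EuclideanSpace ℝ (Fin k))
  f : EuclideanSpace ℝ (Fin k) → ℝ → ℝ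

namespace ParamFamily

variable {k : ℕ} (M : ParamFamily k) (h : ℝ → ℝ)

/-- The density `q (y ; θ) = ∫ f_θ(s) h(y - s) ds` of the observation. -/
def q (θ : EuclideanSpace ℝ (Fin k)) (y : ℝ) : ℝ :=
  ∫ s, M.f θ s * h (y - s)

/-- The distribution `Q_θ` of the observation. -/
def Q (θ : EuclideanSpace ℝ (Fin k)) : Measure ℝ :=
  densityMeasure (M.q h θ)

/-- The score function: the gradient of `q (y ; ·)` (on `Θ`) at `θ`, divided by `q (y ; θ)`,
where `q (y ; θ) > 0`, and zero elsewhere. -/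
def score (θ : EuclideanSpace ℝ (Fin k)) : ℝ → EuclideanSpace ℝ (Fin k) :=
  Set.indicator {y | 0 < M.q h θ y} fun y =>
    (M.q h θ y)⁻¹ • gradientWithin (fun θ' => M.q h θ' y) M.Θ θ

/-- The Fisher information matrix. -/
def fisher (θ : EuclideanSpace ℝ (Fin k)) : Matrix (Fin k) (Fin k) ℝ :=
  Matrix.of fun i j => ∫ y, M.score h θ y i * M.score h θ y j ∂(M.Q h θ)

/-- The family gives a regular deconvolution problem. -/
structure IsRegular : Prop where
  contDiff : ∀ θ ∈ M.Θ, ∀ᵐ y, ContDiffWithinAt ℝ 1 (fun θ' => M.q h θ' y) M.Θ θ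
  memLp_score : ∀ θ ∈ M.Θ, MemLp (M.score h θ) 2 (M.Q h θ)
  fisher_nonsingular : ∀ θ ∈ M.Θ, IsUnit (M.fisher h θ)
  fisher_continuous : ContinuousOn (M.fisher h) M.Θ

/-- The efficient score vector for testing `θ = 0`. -/
def effScore : ℝ → EuclideanSpace ℝ (Fin k) := M.score h 0

/-- The matrix `L`: the inverse of the second moment matrix of the efficient score under the
null hypothesis. -/
def L : Matrix (Fin k) (Fin k) ℝ :=
  (Matrix.of fun i j => ∫ y, M.effScore h y i * M.effScore h y j ∂(M.Q h 0))⁻¹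

/-- The score test statistic `U_k` computed from the first `n` terms of the sequence `y`. -/
def U (n : ℕ) (y : ℕ → ℝ) : ℝ :=
  let v : Fin k → ℝ := fun i => (1 / √(n : ℝ)) * ∑ j ∈ Finset.range n, M.effScore h (y j) i
  v ⬝ᵥ (M.L h *ᵥ v)

end ParamFamily

/-- Extension of a vector by zeros (the inclusion of `ℝ^k` in `ℝ^l`, for `k ≤ l`). -/
def padZero (k l : ℕ) (θ : EuclideanSpace ℝ (Fin k)) : EuclideanSpace ℝ (Fin l) :=
  WithLp.toLp 2 fun i => if hi : (i : ℕ) < k then θ ⟨i, hi⟩ else 0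

/-- A nested sequence of parametric families of densities, of dimensions `1, …, d`, all
containing the null density `f₀` as the member with parameter `0`. -/
structure IsNested (d : ℕ) (f₀ : ℝ → ℝ) (M : ∀ k, ParamFamily k) : Prop where
  isDensity : ∀ k, 1 ≤ k → k ≤ d → ∀ θ ∈ (M k).Θ, IsDensity ((M k).f θ)
  /-- Derivatives relative to the parameter set are unique; every open set has this property. -/
  uniqueDiffOn : ∀ k, 1 ≤ k → k ≤ d → UniqueDiffOn ℝ (M k).Θ
  zero_mem : ∀ k, 1 ≤ k → k ≤ d → (0 : EuclideanSpace ℝ (Fin k)) ∈ (M k).Θ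
  f_zero : ∀ k, 1 ≤ k → k ≤ d → (M k).f 0 =ᵐ[volume] f₀
  subset : ∀ k l, 1 ≤ k → k ≤ l → l ≤ d → ∀ θ ∈ (M k).Θ, padZero k l θ ∈ (M l).Θ
  f_eq : ∀ k l, 1 ≤ k → k ≤ l → l ≤ d → ∀ θ ∈ (M k).Θ,
    (M l).f (padZero k l θ) =ᵐ[volume] (M k).f θ

/-- `π k n` is the penalty attributed to the `k`-th model and the sample size `n`. -/
structure IsPenalty (d : ℕ) (π : ℕ → ℕ → ℝ) : Prop where
  strictMono : ∀ n, 1 ≤ n → ∀ i j, 1 ≤ i → i < j → j ≤ d → π i n < π j n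
  tendsto : ∀ j, 2 ≤ j → j ≤ d → Tendsto (fun n => π j n - π 1 n) atTop atTop

/-- The selection rule `S`, computed from the first `n` terms of the sequence `y`. -/
def selection (d : ℕ) (M : ∀ k, ParamFamily k) (h : ℝ → ℝ) (π : ℕ → ℕ → ℝ)
    (n : ℕ) (y : ℕ → ℝ) : ℕ :=
  sInf {k | 1 ≤ k ∧ k ≤ d ∧ ∀ j, 1 ≤ j → j ≤ d →
    (M j).U h n y - π j n ≤ (M k).U h n y - π k n}

/-- The data-driven statistic `U_S`. -/
def dataDrivenU (d : ℕ) (M : ∀ k, ParamFamily k) (h : ℝ → ℝ) (π : ℕ → ℕ → ℝ)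
    (n : ℕ) (y : ℕ → ℝ) : ℝ :=
  (M (selection d M h π n y)).U h n y

/-- The integer `K`, `1 ≤ K ≤ d`, is the first index for which the coordinate of the efficient
score has nonzero expectation when `X` has law `F`, i.e. with respect to `F ∗ h`; the
expectations up to index `K` exist. The coordinate with index `i : Fin d` is the `(i + 1)`-th. -/
structure ConditionD1 (d : ℕ) (M : ParamFamily d) (h : ℝ → ℝ) (F : Measure ℝ) (K : ℕ) :
    Prop where
  one_le : 1 ≤ K
  le_d : K ≤ d
  integrable : ∀ i : Fin d, (i : ℕ) + 1 ≤ K →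
    Integrable (fun y => M.effScore h y i) (F.conv (densityMeasure h))
  eq_zero : ∀ i : Fin d, (i : ℕ) + 1 < K →
    ∫ y, M.effScore h y i ∂(F.conv (densityMeasure h)) = 0
  ne_zero : ∀ i : Fin d, (i : ℕ) + 1 = K →
    ∫ y, M.effScore h y i ∂(F.conv (densityMeasure h)) ≠ 0

/-- `X 0, X 1, …` are i.i.d. with law `F`, the errors `ε 0, ε 1, …` are i.i.d. with density `h`,
and all these variables are independent. -/
structure IsSample {Ω : Type*} [MeasurableSpace Ω] (P : Measure Ω) (F : Measure ℝ) (h : ℝ → ℝ)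
    (X ε : ℕ → Ω → ℝ) : Prop where
  law_X : ∀ i, HasLaw (X i) F P
  law_ε : ∀ i, HasLaw (ε i) (densityMeasure h) P
  indep_pair : ∀ i, IndepFun (X i) (ε i) P
  iIndep : iIndepFun (fun i ω => (X i ω, ε i ω)) P

end SimpleDeconvolution

end

/-!
The scores of nested families at `0` are a.e. truncations of the score of the largest one, so the
Fisher matrix of the `k`-th family is a principal submatrix of a nonsingular Gram matrix and `L_k`
is positive definite. By the strong law of large numbers `U_k / n` tends to `m_kᵀ L_k m_k`, where
`m_k` consists of the first `k` means of the score: this limit is `0` for `k < K` and positive for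
`k = K`. The penalties are `o(n)`, so each `k < K` loses against `K` with probability tending to
one. On `S ≥ K` maximality of `U_S - π(S, n)` gives `U_S ≥ U_K + π(S, n) - π(K, n) ≥ U_K`, and
`U_K` grows linearly in `n`.
-/

namespace SimpleDeconvolution

/-! ### Nested parameter sets -/

/-- The inclusion `padZero k l` of `ℝ^k` in `ℝ^l` as a continuous linear map, to which the chain
rule applies. -/
noncomputable def padZeroCLM (k l : ℕ) :
    EuclideanSpace ℝ (Fin k) →L[ℝ] EuclideanSpace ℝ (Fin l) :=
  LinearMap.toContinuousLinearMap
    { toFun := padZero k l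
      map_add' := fun x y => by
        ext i
        by_cases hi : (i : ℕ) < k <;> simp [padZero, hi]
      map_smul' := fun c x => by
        ext i
        by_cases hi : (i : ℕ) < k <;> simp [padZero, hi] }

theorem padZeroCLM_apply (k l : ℕ) (θ : EuclideanSpace ℝ (Fin k)) :
    padZeroCLM k l θ = padZero k l θ := rfl

theorem padZero_zero (k l : ℕ) : padZero k l 0 = 0 :=
  map_zero (padZeroCLM k l)

theorem padZero_single {k l : ℕ} (hkl : k ≤ l) (i : Fin k) (a : ℝ) :
    padZero k l (EuclideanSpace.single i a) = EuclideanSpace.single (Fin.castLE hkl i) a := by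
  ext j
  by_cases hj : (j : ℕ) < k
  · simp [padZero, hj, Fin.ext_iff]
  · have hne : j ≠ Fin.castLE hkl i := fun h => hj (by rw [h]; exact i.2)
    simp [padZero, hj, hne]

theorem gradientWithin_apply {ι : Type*} [Fintype ι] [DecidableEq ι] (g : EuclideanSpace ℝ ι → ℝ)
    (s : Set (EuclideanSpace ℝ ι)) (θ : EuclideanSpace ℝ ι) (i : ι) :
    gradientWithin g s θ i = fderivWithin ℝ g s θ (EuclideanSpace.single i 1) := by
  rw [← inner_gradientWithin_left, real_inner_comm, EuclideanSpace.inner_single_left]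
  simp

theorem gradientWithin_comp_padZero_apply {k l : ℕ} (hkl : k ≤ l)
    {g : EuclideanSpace ℝ (Fin l) → ℝ} {s : Set (EuclideanSpace ℝ (Fin k))}
    {t : Set (EuclideanSpace ℝ (Fin l))} {θ : EuclideanSpace ℝ (Fin k)}
    (hg : DifferentiableWithinAt ℝ g t (padZero k l θ)) (hst : Set.MapsTo (padZero k l) s t)
    (hs : UniqueDiffWithinAt ℝ s θ) (i : Fin k) :
    gradientWithin (g ∘ padZero k l) s θ i =
      gradientWithin g t (padZero k l θ) (Fin.castLE hkl i) := by
  have hcomp : HasFDerivWithinAt (g ∘ padZero k l)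
      ((fderivWithin ℝ g t (padZero k l θ)).comp (padZeroCLM k l)) s θ :=
    hg.hasFDerivWithinAt.comp θ (padZeroCLM k l).hasFDerivWithinAt hst
  rw [gradientWithin_apply, gradientWithin_apply, hcomp.fderivWithin hs,
    ContinuousLinearMap.comp_apply, padZeroCLM_apply, padZero_single hkl]

/-! ### Scores and Fisher information of nested families -/

theorem densityMeasure_absolutelyContinuous (g : ℝ → ℝ) : densityMeasure g ≪ volume :=
  withDensity_absolutelyContinuous _ _

/-- Regularity of a family at a single parameter `θ`, with differentiability of `q (y ; ·)` in
place of continuous differentiability. -/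
structure ParamFamily.IsRegularAt {k : ℕ} (M : ParamFamily k) (h : ℝ → ℝ)
    (θ : EuclideanSpace ℝ (Fin k)) : Prop where
  differentiableWithinAt : ∀ᵐ y, DifferentiableWithinAt ℝ (fun θ' => M.q h θ' y) M.Θ θ
  memLp_score : MemLp (M.score h θ) 2 (M.Q h θ)
  fisher_nonsingular : IsUnit (M.fisher h θ)

theorem ParamFamily.IsRegular.isRegularAt {k : ℕ} {M : ParamFamily k} {h : ℝ → ℝ}
    (hM : M.IsRegular h) {θ : EuclideanSpace ℝ (Fin k)} (hθ : θ ∈ M.Θ) : M.IsRegularAt h θ where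
  differentiableWithinAt :=
    (hM.contDiff θ hθ).mono fun _ hy => hy.differentiableWithinAt one_ne_zero
  memLp_score := hM.memLp_score θ hθ
  fisher_nonsingular := hM.fisher_nonsingular θ hθ

theorem posSemidef_integral_mul {α ι : Type*} [MeasurableSpace α] [Finite ι] {μ : Measure α}
    {g : ι → α → ℝ} (hg : ∀ i, MemLp (g i) 2 μ) :
    (Matrix.of fun i j => ∫ x, g i x * g j x ∂μ).PosSemidef := by
  have hgram : (Matrix.of fun i j => ∫ x, g i x * g j x ∂μ) =
      Matrix.gram ℝ fun i => (hg i).toLp (g i) := by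
    ext i j
    rw [Matrix.gram_apply, L2.inner_def, Matrix.of_apply]
    refine integral_congr_ae ?_
    filter_upwards [(hg i).coeFn_toLp, (hg j).coeFn_toLp] with x hi hj
    rw [hi, hj, real_inner_comm, RCLike.inner_apply, conj_trivial]
  exact hgram ▸ Matrix.posSemidef_gram ℝ _

theorem ParamFamily.IsRegularAt.posDef_fisher {k : ℕ} {M : ParamFamily k} {h : ℝ → ℝ}
    {θ : EuclideanSpace ℝ (Fin k)} (hM : M.IsRegularAt h θ) : (M.fisher h θ).PosDef :=
  (posSemidef_integral_mul hM.memLp_score.eval_piLp).posDef_iff_isUnit.2 hM.fisher_nonsingular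

namespace IsNested

variable {d : ℕ} {f₀ : ℝ → ℝ} {M : ∀ k, ParamFamily k} (hM : IsNested d f₀ M) {h : ℝ → ℝ}
  {k l : ℕ} (hk : 1 ≤ k) (hkl : k ≤ l) (hl : l ≤ d)

include hM hk hkl hl

theorem q_padZero {θ : EuclideanSpace ℝ (Fin k)} (hθ : θ ∈ (M k).Θ) :
    (M l).q h (padZero k l θ) = (M k).q h θ := by
  ext y
  refine integral_congr_ae ?_
  filter_upwards [hM.f_eq k l hk hkl hl θ hθ] with s hs
  rw [hs]

theorem score_ae_eq {θ : EuclideanSpace ℝ (Fin k)} (hθ : θ ∈ (M k).Θ)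
    (hdiff : ∀ᵐ y, DifferentiableWithinAt ℝ (fun θ' => (M l).q h θ' y) (M l).Θ (padZero k l θ)) :
    ∀ᵐ y, ∀ i : Fin k,
      (M k).score h θ y i = (M l).score h (padZero k l θ) y (Fin.castLE hkl i) := by
  filter_upwards [hdiff] with y hy i
  have hgrad : gradientWithin (fun θ' => (M k).q h θ' y) (M k).Θ θ i =
      gradientWithin (fun θ' => (M l).q h θ' y) (M l).Θ (padZero k l θ) (Fin.castLE hkl i) := by
    rw [← gradientWithin_comp_padZero_apply hkl hy (hM.subset k l hk hkl hl)
        (hM.uniqueDiffOn k hk (hkl.trans hl) θ hθ), gradientWithin_apply, gradientWithin_apply]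
    congr 1
    exact fderivWithin_congr (fun θ' hθ' => (congrFun (hM.q_padZero hk hkl hl hθ') y).symm)
      (congrFun (hM.q_padZero hk hkl hl hθ) y).symm
  by_cases hpos : 0 < (M k).q h θ y <;>
    simp [ParamFamily.score, Set.indicator, hM.q_padZero hk hkl hl hθ, hpos, hgrad]

theorem fisher_eq_submatrix {θ : EuclideanSpace ℝ (Fin k)} (hθ : θ ∈ (M k).Θ)
    (hdiff : ∀ᵐ y, DifferentiableWithinAt ℝ (fun θ' => (M l).q h θ' y) (M l).Θ (padZero k l θ)) :
    (M k).fisher h θ =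
      ((M l).fisher h (padZero k l θ)).submatrix (Fin.castLE hkl) (Fin.castLE hkl) := by
  have hQ : (M l).Q h (padZero k l θ) = (M k).Q h θ :=
    congrArg densityMeasure (hM.q_padZero hk hkl hl hθ)
  ext i j
  rw [Matrix.submatrix_apply, ParamFamily.fisher, ParamFamily.fisher, Matrix.of_apply,
    Matrix.of_apply, hQ]
  refine integral_congr_ae ?_
  filter_upwards [(densityMeasure_absolutelyContinuous _).ae_le
    (hM.score_ae_eq hk hkl hl hθ hdiff)] with y hy
  rw [hy i, hy j]

theorem effScore_ae_eq (hreg : (M l).IsRegularAt h 0) :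
    ∀ᵐ y, ∀ i : Fin k, (M k).effScore h y i = (M l).effScore h y (Fin.castLE hkl i) := by
  have hae := hM.score_ae_eq hk hkl hl (hM.zero_mem k hk (hkl.trans hl))
    ((padZero_zero k l).symm ▸ hreg.differentiableWithinAt)
  rwa [padZero_zero] at hae

theorem posDef_L (hreg : (M l).IsRegularAt h 0) : ((M k).L h).PosDef := by
  have hfisher := hM.fisher_eq_submatrix hk hkl hl (hM.zero_mem k hk (hkl.trans hl))
    ((padZero_zero k l).symm ▸ hreg.differentiableWithinAt)
  rw [padZero_zero] at hfisher
  have hpos : ((M k).fisher h 0).PosDef :=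
    hfisher ▸ hreg.posDef_fisher.submatrix (Fin.castLE_injective hkl)
  exact hpos.inv

end IsNested

/-- Condition ⟨D1⟩ for an arbitrary random vector `s` on `(α, μ)`: the `K`-th coordinate is the
first one with nonzero mean. As in `ConditionD1`, the index `i : Fin d` stands for the `(i + 1)`-th
coordinate. -/
structure IsFirstNonzeroMean {α : Type*} [MeasurableSpace α] {d : ℕ}
    (s : α → EuclideanSpace ℝ (Fin d)) (μ : Measure α) (K : ℕ) : Prop where
  one_le : 1 ≤ K
  le_d : K ≤ d
  integrable : ∀ i : Fin d, (i : ℕ) + 1 ≤ K → Integrable (fun y => s y i) μ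
  eq_zero : ∀ i : Fin d, (i : ℕ) + 1 < K → ∫ y, s y i ∂μ = 0
  ne_zero : ∀ i : Fin d, (i : ℕ) + 1 = K → ∫ y, s y i ∂μ ≠ 0

theorem ConditionD1.isFirstNonzeroMean {d : ℕ} {M : ParamFamily d} {h : ℝ → ℝ} {F : Measure ℝ}
    {K : ℕ} (hD1 : ConditionD1 d M h F K) :
    IsFirstNonzeroMean (M.effScore h) (F.conv (densityMeasure h)) K :=
  ⟨hD1.one_le, hD1.le_d, hD1.integrable, hD1.eq_zero, hD1.ne_zero⟩

namespace IsFirstNonzeroMean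

variable {α : Type*} [MeasurableSpace α] {μ : Measure α} {d k K : ℕ}
  {s : α → EuclideanSpace ℝ (Fin d)} {s' : α → EuclideanSpace ℝ (Fin k)}
  (hs : IsFirstNonzeroMean s μ K) (hkd : k ≤ d)
  (hss' : ∀ᵐ y ∂μ, ∀ i : Fin k, s' y i = s y (Fin.castLE hkd i))

include hs hss'

theorem integrable_apply (hkK : k ≤ K) (i : Fin k) : Integrable (fun y => s' y i) μ :=
  (hs.integrable (Fin.castLE hkd i) (i.2.trans_le hkK)).congr <|
    hss'.mono fun _ hy => (hy i).symm

theorem integrable_truncation (hkK : k ≤ K) : Integrable s' μ :=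
  .of_eval_piLp (hs.integrable_apply hkd hss' hkK)

theorem integral_apply (hkK : k ≤ K) (i : Fin k) :
    (∫ y, s' y ∂μ) i = ∫ y, s y (Fin.castLE hkd i) ∂μ := by
  rw [eval_integral_piLp (hs.integrable_apply hkd hss' hkK)]
  exact integral_congr_ae (hss'.mono fun _ hy => hy i)

theorem integral_eq_zero (hkK : k < K) : ∫ y, s' y ∂μ = 0 := by
  ext i
  rw [hs.integral_apply hkd hss' hkK.le]
  exact hs.eq_zero _ (Nat.lt_of_le_of_lt i.2 hkK)

theorem integral_ne_zero (hkK : k = K) : ∫ y, s' y ∂μ ≠ 0 := by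
  subst hkK
  have hlast : k - 1 + 1 = k := Nat.sub_add_cancel hs.one_le
  intro hzero
  apply hs.ne_zero (Fin.castLE hkd ⟨k - 1, by omega⟩) hlast
  rw [← hs.integral_apply hkd hss' le_rfl, hzero, PiLp.zero_apply]

end IsFirstNonzeroMean

/-! ### The law of large numbers for the score statistic -/

namespace IsSample

variable {Ω : Type*} [MeasurableSpace Ω] {P : Measure Ω} {F : Measure ℝ} {h : ℝ → ℝ}
  {X ε : ℕ → Ω → ℝ}

theorem hasLaw_add [IsProbabilityMeasure P] (hs : IsSample P F h X ε) (j : ℕ) :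
    HasLaw (fun ω => X j ω + ε j ω) (F.conv (densityMeasure h)) P := by
  have : IsProbabilityMeasure F := (hs.law_X j).isProbabilityMeasure_iff.1 inferInstance
  have : IsProbabilityMeasure (densityMeasure h) :=
    (hs.law_ε j).isProbabilityMeasure_iff.1 inferInstance
  exact (hs.indep_pair j).hasLaw_add (hs.law_X j) (hs.law_ε j)

theorem pairwise_indepFun_add (hs : IsSample P F h X ε) :
    Pairwise fun i j => IndepFun (fun ω => X i ω + ε i ω) (fun ω => X j ω + ε j ω) P :=
  fun _ _ hij => (hs.iIndep.indepFun hij).comp (measurable_fst.add measurable_snd)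
    (measurable_fst.add measurable_snd)

end IsSample

theorem conv_densityMeasure_absolutelyContinuous (F : Measure ℝ) (h : ℝ → ℝ) :
    F.conv (densityMeasure h) ≪ volume := by
  have : SFinite (densityMeasure h) := by
    rw [densityMeasure]
    infer_instance
  exact Measure.conv_absolutelyContinuous (densityMeasure_absolutelyContinuous h)

theorem ae_tendsto_average_of_hasLaw {Ω 𝓧 E : Type*} [MeasurableSpace Ω] [MeasurableSpace 𝓧]
    [NormedAddCommGroup E] [NormedSpace ℝ E] [CompleteSpace E] [MeasurableSpace E] [BorelSpace E]
    {P : Measure Ω} {μ : Measure 𝓧} {Y : ℕ → Ω → 𝓧} (hlaw : ∀ j, HasLaw (Y j) μ P)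
    (hindep : Pairwise fun i j => IndepFun (Y i) (Y j) P) {g : 𝓧 → E} (hg : Integrable g μ) :
    ∀ᵐ ω ∂P, Tendsto (fun n : ℕ => (n : ℝ)⁻¹ • ∑ j ∈ Finset.range n, g (Y j ω)) atTop
      (𝓝 (∫ y, g y ∂μ)) := by
  have hgm : ∀ j, AEMeasurable g (P.map (Y j)) := fun j =>
    (hlaw j).map_eq.symm ▸ hg.aestronglyMeasurable.aemeasurable
  have hint : Integrable (fun ω => g (Y 0 ω)) P :=
    ((hlaw 0).map_eq.symm ▸ hg : Integrable g (P.map (Y 0))).comp_aemeasurable (hlaw 0).aemeasurable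
  have hmean : ∫ ω, g (Y 0 ω) ∂P = ∫ y, g y ∂μ := (hlaw 0).integral_comp hg.aestronglyMeasurable
  rw [← hmean]
  exact strong_law_ae (fun j ω => g (Y j ω)) hint
    (fun i j hij => (hindep hij).comp₀ (hlaw i).aemeasurable (hlaw j).aemeasurable (hgm i) (hgm j))
    (fun i => ((hlaw i).identDistrib (hlaw 0)).comp_of_aemeasurable (hgm i))

namespace ParamFamily

variable {k : ℕ} (M : ParamFamily k) (h : ℝ → ℝ)

/-- The quadratic form `v ↦ vᵀ L v`, whose value at `n ^ (-1/2) ∑ l*(Y_j)` is `U_k`. -/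
noncomputable def scoreForm (v : EuclideanSpace ℝ (Fin k)) : ℝ :=
  v.ofLp ⬝ᵥ (M.L h *ᵥ v.ofLp)

theorem continuous_scoreForm : Continuous (M.scoreForm h) := by
  unfold scoreForm
  fun_prop

theorem scoreForm_zero : M.scoreForm h 0 = 0 := by
  simp [scoreForm]

theorem scoreForm_smul (c : ℝ) (v : EuclideanSpace ℝ (Fin k)) :
    M.scoreForm h (c • v) = c ^ 2 * M.scoreForm h v := by
  simp only [scoreForm, WithLp.ofLp_smul, Matrix.mulVec_smul, smul_dotProduct, dotProduct_smul,
    smul_eq_mul]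
  ring

variable {M h} in
theorem scoreForm_pos (hL : (M.L h).PosDef) {v : EuclideanSpace ℝ (Fin k)} (hv : v ≠ 0) :
    0 < M.scoreForm h v := by
  simpa [scoreForm] using hL.dotProduct_mulVec_pos (x := v.ofLp) (by simpa using hv)

theorem U_eq_scoreForm (n : ℕ) (y : ℕ → ℝ) :
    M.U h n y = M.scoreForm h ((√(n : ℝ))⁻¹ • ∑ j ∈ Finset.range n, M.effScore h (y j)) := by
  simp [U, scoreForm, Pi.smul_def]

theorem U_div_eq_scoreForm (n : ℕ) (y : ℕ → ℝ) :
    M.U h n y / n = M.scoreForm h ((n : ℝ)⁻¹ • ∑ j ∈ Finset.range n, M.effScore h (y j)) := by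
  rw [U_eq_scoreForm, scoreForm_smul, scoreForm_smul, inv_pow, Real.sq_sqrt n.cast_nonneg]
  ring

variable {Ω : Type*} [MeasurableSpace Ω] {P : Measure Ω} {μ : Measure ℝ} {Y : ℕ → Ω → ℝ} {M h}

theorem aemeasurable_U (hlaw : ∀ j, HasLaw (Y j) μ P) (hM : AEMeasurable (M.effScore h) μ)
    (n : ℕ) : AEMeasurable (fun ω => M.U h n fun j => Y j ω) P := by
  simp only [U_eq_scoreForm]
  refine (M.continuous_scoreForm h).measurable.comp_aemeasurable ?_
  have hterm (j : ℕ) : AEMeasurable (fun ω => M.effScore h (Y j ω)) P :=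
    ((hlaw j).map_eq.symm ▸ hM : AEMeasurable _ (P.map (Y j))).comp_aemeasurable
      (hlaw j).aemeasurable
  exact (Finset.aemeasurable_fun_sum (Finset.range n) fun j _ => hterm j).const_smul (√(n : ℝ))⁻¹

theorem ae_tendsto_U_div (hlaw : ∀ j, HasLaw (Y j) μ P)
    (hindep : Pairwise fun i j => IndepFun (Y i) (Y j) P) (hM : Integrable (M.effScore h) μ) :
    ∀ᵐ ω ∂P, Tendsto (fun n : ℕ => M.U h n (fun j => Y j ω) / n) atTop
      (𝓝 (M.scoreForm h (∫ y, M.effScore h y ∂μ))) := by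
  simp only [U_div_eq_scoreForm]
  filter_upwards [ae_tendsto_average_of_hasLaw hlaw hindep hM] with ω hω
  exact ((M.continuous_scoreForm h).tendsto _).comp hω

theorem tendstoInMeasure_U_sub_div [IsFiniteMeasure P] (hlaw : ∀ j, HasLaw (Y j) μ P)
    (hindep : Pairwise fun i j => IndepFun (Y i) (Y j) P) (hM : Integrable (M.effScore h) μ)
    {p : ℕ → ℝ} (hp : p =o[atTop] fun n : ℕ => (n : ℝ)) :
    TendstoInMeasure P (fun (n : ℕ) ω => (M.U h n (fun j => Y j ω) - p n) / n) atTop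
      fun _ => M.scoreForm h (∫ y, M.effScore h y ∂μ) := by
  refine tendstoInMeasure_of_tendsto_ae (fun n => ?_) ?_
  · have hU := aemeasurable_U hlaw hM.aestronglyMeasurable.aemeasurable n
    exact ((hU.sub_const _).div_const _).aestronglyMeasurable
  · filter_upwards [ae_tendsto_U_div hlaw hindep hM] with ω hω
    simpa only [sub_div, sub_zero] using hω.sub hp.tendsto_div_nhds_zero

end ParamFamily

/-! ### Convergence in probability -/

theorem tendsto_measure_setOf_le_of_tendstoInMeasure {ι α : Type*} [MeasurableSpace α]
    {μ : Measure α} {l : Filter ι} {u v : ι → α → ℝ} {a b : ℝ} (hab : a < b)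
    (hu : TendstoInMeasure μ u l fun _ => a) (hv : TendstoInMeasure μ v l fun _ => b) :
    Tendsto (fun i => μ {x | v i x ≤ u i x}) l (𝓝 0) := by
  have hε : 0 < (b - a) / 2 := half_pos (sub_pos.2 hab)
  have hsum := (tendstoInMeasure_iff_dist.1 hu _ hε).add (tendstoInMeasure_iff_dist.1 hv _ hε)
  rw [add_zero] at hsum
  refine tendsto_of_tendsto_of_tendsto_of_le_of_le tendsto_const_nhds hsum (fun _ => zero_le)
    fun i => (measure_mono fun x hx => ?_).trans (measure_union_le _ _)
  by_contra! hnot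
  simp only [Set.mem_union, Set.mem_ofPred_eq, not_or, not_le, Real.dist_eq, abs_lt] at hnot hx
  linarith [hnot.1.2, hnot.2.1]

theorem tendsto_measure_setOf_le_of_tendstoInMeasure_div {α : Type*} [MeasurableSpace α]
    {μ : Measure α} {u v : ℕ → α → ℝ} {a b : ℝ} (hab : a < b)
    (hu : TendstoInMeasure μ (fun n x => u n x / n) atTop fun _ => a)
    (hv : TendstoInMeasure μ (fun n x => v n x / n) atTop fun _ => b) :
    Tendsto (fun n => μ {x | v n x ≤ u n x}) atTop (𝓝 0) :=
  tendsto_of_tendsto_of_tendsto_of_le_of_le tendsto_const_nhds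
    (tendsto_measure_setOf_le_of_tendstoInMeasure hab hu hv) (fun _ => zero_le)
    fun n => measure_mono fun x (hx : v n x ≤ u n x) =>
      show v n x / n ≤ u n x / n from div_le_div_of_nonneg_right hx n.cast_nonneg

theorem tendsto_measure_setOf_le_const_of_tendstoInMeasure_div {α : Type*} [MeasurableSpace α]
    {μ : Measure α} [IsFiniteMeasure μ] {v : ℕ → α → ℝ} {b : ℝ} (hb : 0 < b)
    (hv : TendstoInMeasure μ (fun n x => v n x / n) atTop fun _ => b) (t : ℝ) :
    Tendsto (fun n => μ {x | v n x ≤ t}) atTop (𝓝 0) :=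
  tendsto_measure_setOf_le_of_tendstoInMeasure_div (u := fun _ _ => t) hb
    (tendstoInMeasure_of_tendsto_ae (fun _ => aestronglyMeasurable_const) <|
      .of_forall fun _ => tendsto_const_div_atTop_nhds_zero_nat t) hv

theorem tendsto_measure_one_of_tendsto_measure_compl {ι α : Type*} [MeasurableSpace α]
    {P : Measure α} [IsProbabilityMeasure P] {l : Filter ι} {A : ι → Set α}
    (hA : Tendsto (fun i => P (A i)ᶜ) l (𝓝 0)) : Tendsto (fun i => P (A i)) l (𝓝 1) := by
  have hsub : Tendsto (fun i => 1 - P (A i)ᶜ) l (𝓝 1) := by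
    simpa using ENNReal.Tendsto.sub tendsto_const_nhds hA (.inl ENNReal.one_ne_top)
  refine tendsto_of_tendsto_of_tendsto_of_le_of_le hsub tendsto_const_nhds (fun i => ?_)
    fun _ => prob_le_one
  rw [tsub_le_iff_right, ← measure_univ (μ := P)]
  exact measure_univ_le_add_compl _

/-! ### The selection rule -/

section Selection

variable {d : ℕ} {M : ∀ k, ParamFamily k} {h : ℝ → ℝ} {π : ℕ → ℕ → ℝ} {n : ℕ} {y : ℕ → ℝ} {K : ℕ}

theorem selection_spec (hd : 1 ≤ d) :
    selection d M h π n y ∈ Set.Icc 1 d ∧ ∀ j ∈ Set.Icc 1 d, (M j).U h n y - π j n ≤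
      (M (selection d M h π n y)).U h n y - π (selection d M h π n y) n := by
  obtain ⟨k, hk, hmax⟩ := Finset.exists_max_image (Finset.Icc 1 d)
    (fun k => (M k).U h n y - π k n) ⟨1, Finset.mem_Icc.2 ⟨le_rfl, hd⟩⟩
  rw [Finset.mem_Icc] at hk
  obtain ⟨hone, hle, hsel⟩ := Nat.sInf_mem (s := {k | 1 ≤ k ∧ k ≤ d ∧ ∀ j, 1 ≤ j → j ≤ d →
      (M j).U h n y - π j n ≤ (M k).U h n y - π k n})
    ⟨k, hk.1, hk.2, fun j hj hjd => hmax j (Finset.mem_Icc.2 ⟨hj, hjd⟩)⟩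
  exact ⟨⟨hone, hle⟩, fun j hj => hsel j hj.1 hj.2⟩

theorem U_le_dataDrivenU (hπ : MonotoneOn (fun k => π k n) (Set.Icc 1 d)) (hK : K ∈ Set.Icc 1 d)
    (hsel : K ≤ selection d M h π n y) : (M K).U h n y ≤ dataDrivenU d M h π n y := by
  obtain ⟨hmem, hmax⟩ := selection_spec (M := M) (h := h) (π := π) (n := n) (y := y)
    (hK.1.trans hK.2)
  have hpen : π K n ≤ π (selection d M h π n y) n := hπ hK hmem hsel
  unfold dataDrivenU
  linarith [hmax K hK]

variable {Ω : Type*} [MeasurableSpace Ω] {P : Measure Ω} {Y : Ω → ℕ → ℝ} {c : ℝ}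

theorem tendsto_measure_selection_lt (hK : K ∈ Set.Icc 1 d) (hc : 0 < c)
    (hlow : ∀ k ∈ Set.Ico 1 K,
      TendstoInMeasure P (fun n ω => ((M k).U h n (Y ω) - π k n) / n) atTop fun _ => 0)
    (htop : TendstoInMeasure P (fun n ω => ((M K).U h n (Y ω) - π K n) / n) atTop fun _ => c) :
    Tendsto (fun n => P {ω | selection d M h π n (Y ω) < K}) atTop (𝓝 0) := by
  have hsum : Tendsto (fun n => ∑ k ∈ Finset.Ico 1 K,
      P {ω | (M K).U h n (Y ω) - π K n ≤ (M k).U h n (Y ω) - π k n}) atTop (𝓝 0) := by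
    simpa using tendsto_finsetSum (Finset.Ico 1 K) fun k hk =>
      tendsto_measure_setOf_le_of_tendstoInMeasure_div hc (hlow k (Finset.mem_Ico.1 hk)) htop
  refine tendsto_of_tendsto_of_tendsto_of_le_of_le tendsto_const_nhds hsum (fun _ => zero_le)
    fun n => (measure_mono fun ω hω => ?_).trans (measure_biUnion_finset_le _ _)
  obtain ⟨hmem, hmax⟩ := selection_spec (M := M) (h := h) (π := π) (n := n) (y := Y ω)
    (hK.1.trans hK.2)
  exact Set.mem_biUnion (Finset.mem_coe.2 (Finset.mem_Ico.2 ⟨hmem.1, hω⟩)) (hmax K hK)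

theorem tendsto_measure_dataDrivenU_le (hπ : ∀ n, 1 ≤ n → MonotoneOn (fun k => π k n) (Set.Icc 1 d))
    (hK : K ∈ Set.Icc 1 d)
    (hsel : Tendsto (fun n => P {ω | selection d M h π n (Y ω) < K}) atTop (𝓝 0)) {t : ℝ}
    (hU : Tendsto (fun n => P {ω | (M K).U h n (Y ω) ≤ t}) atTop (𝓝 0)) :
    Tendsto (fun n => P {ω | dataDrivenU d M h π n (Y ω) ≤ t}) atTop (𝓝 0) := by
  have hsum := hsel.add hU
  rw [add_zero] at hsum
  refine tendsto_of_tendsto_of_tendsto_of_le_of_le' tendsto_const_nhds hsum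
    (.of_forall fun _ => zero_le) ?_
  filter_upwards [eventually_ge_atTop 1] with n hn
  refine (measure_mono fun ω hω => ?_).trans (measure_union_le _ _)
  rcases lt_or_ge (selection d M h π n (Y ω)) K with hlt | hge
  · exact .inl hlt
  · exact .inr ((U_le_dataDrivenU (hπ n hn) hK hge).trans hω)

end Selection

end SimpleDeconvolution

open SimpleDeconvolution in
theorem mainTheorem7_general {Ω : Type*} [MeasurableSpace Ω] {P : Measure Ω}
    [IsProbabilityMeasure P] {h f₀ : ℝ → ℝ} {d : ℕ} {M : ∀ k, ParamFamily k}
    (hM : IsNested d f₀ M) (hreg : (M d).IsRegularAt h 0) {π : ℕ → ℕ → ℝ}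
    (hπ : ∀ n, 1 ≤ n → MonotoneOn (fun k => π k n) (Set.Icc 1 d)) {μ : Measure ℝ}
    (hμ : μ ≪ volume) {Y : ℕ → Ω → ℝ} (hlaw : ∀ j, HasLaw (Y j) μ P)
    (hindep : Pairwise fun i j => IndepFun (Y i) (Y j) P) {K : ℕ}
    (hK : IsFirstNonzeroMean ((M d).effScore h) μ K)
    (hS1 : ∀ k ∈ Set.Icc 1 K, (fun n : ℕ => π k n) =o[atTop] fun n : ℕ => (n : ℝ)) :
    Tendsto (fun n : ℕ => P {ω | K ≤ selection d M h π n fun j => Y j ω}) atTop (𝓝 1) ∧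
    ∀ t : ℝ, Tendsto (fun n : ℕ => P {ω | dataDrivenU d M h π n (fun j => Y j ω) ≤ t})
      atTop (𝓝 0) := by
  have hKd : K ∈ Set.Icc 1 d := ⟨hK.one_le, hK.le_d⟩
  have hscore (k) (hk : k ∈ Set.Icc 1 K) := hμ.ae_le
    (hM.effScore_ae_eq hk.1 (hk.2.trans hK.le_d) le_rfl hreg)
  have hint (k) (hk : k ∈ Set.Icc 1 K) : Integrable ((M k).effScore h) μ :=
    hK.integrable_truncation _ (hscore k hk) hk.2
  have hKmem : K ∈ Set.Icc 1 K := ⟨hK.one_le, le_rfl⟩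
  have hpos : 0 < (M K).scoreForm h (∫ y, (M K).effScore h y ∂μ) :=
    ParamFamily.scoreForm_pos (hM.posDef_L hK.one_le hK.le_d le_rfl hreg)
      (hK.integral_ne_zero _ (hscore K hKmem) rfl)
  have hsel : Tendsto (fun n => P {ω | selection d M h π n (fun j => Y j ω) < K}) atTop (𝓝 0) := by
    refine tendsto_measure_selection_lt hKd hpos (fun k hk => ?_)
      (ParamFamily.tendstoInMeasure_U_sub_div hlaw hindep (hint K hKmem) (hS1 K hKmem))
    have hkmem : k ∈ Set.Icc 1 K := ⟨hk.1, hk.2.le⟩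
    simpa only [hK.integral_eq_zero _ (hscore k hkmem) hk.2, ParamFamily.scoreForm_zero] using
      ParamFamily.tendstoInMeasure_U_sub_div hlaw hindep (hint k hkmem) (hS1 k hkmem)
  refine ⟨tendsto_measure_one_of_tendsto_measure_compl ?_, fun t => ?_⟩
  · simpa only [Set.compl_ofPred, not_le] using hsel
  · refine tendsto_measure_dataDrivenU_le hπ hKd hsel
      (tendsto_measure_setOf_le_const_of_tendstoInMeasure_div hpos ?_ t)
    simpa only [sub_zero] using
      ParamFamily.tendstoInMeasure_U_sub_div hlaw hindep (hint K hKmem) (isLittleO_zero _ _)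

theorem mainTheorem7 {Ω : Type*} [MeasurableSpace Ω] (P : Measure Ω) [IsProbabilityMeasure P]
    (h f₀ : ℝ → ℝ) (hh : SimpleDeconvolution.IsNoiseDensity h)
    (hf₀ : SimpleDeconvolution.IsDensity f₀)
    (d : ℕ) (M : ∀ k, SimpleDeconvolution.ParamFamily k)
    (hM : SimpleDeconvolution.IsNested d f₀ M)
    (hreg : ∀ k, 1 ≤ k → k ≤ d → (M k).IsRegular h)
    (π : ℕ → ℕ → ℝ) (hπ : SimpleDeconvolution.IsPenalty d π)
    (F : Measure ℝ) [IsProbabilityMeasure F]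
    (X ε : ℕ → Ω → ℝ) (hsample : SimpleDeconvolution.IsSample P F h X ε)
    (K : ℕ) (hD1 : SimpleDeconvolution.ConditionD1 d (M d) h F K)
    (hS1 : ∀ k, 1 ≤ k → (fun n : ℕ => π k n) =o[atTop] fun n : ℕ => (n : ℝ)) :
    Tendsto (fun n : ℕ =>
        P {ω | K ≤ SimpleDeconvolution.selection d M h π n (fun j => X j ω + ε j ω)})
      atTop (𝓝 1) ∧
    ∀ t : ℝ, Tendsto (fun n : ℕ =>
        P {ω | SimpleDeconvolution.dataDrivenU d M h π n (fun j => X j ω + ε j ω) ≤ t})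
      atTop (𝓝 0) :=
  mainTheorem7_general hM
    ((hreg d (hD1.one_le.trans hD1.le_d) le_rfl).isRegularAt
      (hM.zero_mem d (hD1.one_le.trans hD1.le_d) le_rfl))
    (fun n hn => StrictMonoOn.monotoneOn fun i hi j hj hij =>
      hπ.strictMono n hn i j hi.1 hij hj.2)
    (SimpleDeconvolution.conv_densityMeasure_absolutelyContinuous F h) hsample.hasLaw_add
    hsample.pairwise_indepFun_add hD1.isFirstNonzeroMean fun k hk => hS1 k hk.1
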